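/- **Proposition (generalized Kaiblinger formula).** Let $d\ge 0$ and let $f,g$ belong to Feichtinger's algebra $M^1(\mathbb R^d)$, i.e. $f,g$ are (continuous representatives of) tempered distributions whose short-time Fourier transform with respect to some non-zero Schwartz window is integrable over $\mathbb R^{2d}$. Let $\Lambda$ be a (full-rank) lattice in $\mathbb R^d\times\mathbb R^d$, let $|\Lambda|$ be the Lebesgue measure of a fundamental domain of $\Lambda$, and let $$\Lambda^0=\{z\in\mathbb R^{2d} : \pi(\lambda)\pi(z)=\pi(z)\pi(\lambda)\ \text{on } L^2(\mathbb R^d)\ \text{for all }\lambda\in\Lambda\}$$ be its adjoint lattice, where $\pi(x,\omega)h(t)=e^{2\pi i\omega\cdot t}h(t-x)$. Then $$\sum_{\lambda\in\Lambda}V_gf(\lambda)=|\Lambda|^{-1}\sum_{\lambda^0\in\Lambda^0}R(f,g)(\lambda^0),$$ with absolute convergence of both sums. Here $$V_gf(x,\omega)=\int_{\mathbb R^d}f(t)\,\overline{g(t-x)}\,e^{-2\pi i\omega\cdot t}\,dt$$ is the short-time Fourier transform and $$R(f,g)(x,\omega)=f(x)\,\overline{\hat g(\omega)}\,e^{-2\pi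 i x\cdot\omega},\qquad \hat g(\omega)=\int_{\mathbb R^d}g(t)e^{-2\pi i\omega\cdot t}\,dt,$$ is the Rihaczek distribution. -/

import Mathlib

open MeasureTheory
open scoped FourierTransform SchwartzMap ComplexConjugate

noncomputable section

/-- The space `ℝ^d` with its Euclidean inner product `x · y`. -/
abbrev TFSpace (d : ℕ) : Type := EuclideanSpace ℝ (Fin d)

/-- The time-frequency plane `ℝ^d × ℝ^d`, with points `(x, ω)`. -/
abbrev TFPlane (d : ℕ) : Type := TFSpace d × TFSpace d

/-- The time-frequency shift `(π(x, ω) h)(t) = e^{2πi ω·t} h(t - x)`. -/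
def tfShift {d : ℕ} (z : TFPlane d) (h : TFSpace d → ℂ) (t : TFSpace d) : ℂ :=
  Complex.exp (2 * (Real.pi : ℂ) * Complex.I * ((inner ℝ z.2 t : ℝ) : ℂ)) * h (t - z.1)

/-- The short-time Fourier transform
`V_g f (x, ω) = ∫ f(t) conj(g(t - x)) e^{-2πi ω·t} dt`. -/
def stft {d : ℕ} (g f : TFSpace d → ℂ) (z : TFPlane d) : ℂ :=
  ∫ t : TFSpace d, f t * conj (g (t - z.1)) *
    Complex.exp (-(2 * (Real.pi : ℂ) * Complex.I * ((inner ℝ z.2 t : ℝ) : ℂ)))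

/-- Membership in Feichtinger's algebra `M^1(ℝ^d)`. Its elements are the tempered distributions
whose short-time Fourier transform with respect to a nonzero Schwartz window is integrable over the
time-frequency plane. They are continuous functions, and since point values are used below, an
element is given here by its (unique) continuous representative. -/
structure MemFeichtingerAlgebra {d : ℕ} (f : TFSpace d → ℂ) : Prop where
  continuous : Continuous f
  /-- `f` defines a tempered distribution by integration against Schwartz functions. -/
  tempered : ∀ ψ : 𝓢(TFSpace d, ℂ), Integrable (fun t => f t * ψ t) volume
  /-- The `M^1`-norm of `f` is finite. -/
  integrable_stft : ∃ φ : 𝓢(TFSpace d, ℂ), φ ≠ 0 ∧ Integrable (stft (fun t => φ t) f) volume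

/-- The adjoint `Λ⁰` of a set `Λ` of time-frequency shifts: all points `z` of the time-frequency
plane such that `π(z)` commutes with every `π(l)`, `l ∈ Λ`, as operators on `L²(ℝ^d)`. -/
def adjointLattice {d : ℕ} (Λ : Set (TFPlane d)) : Set (TFPlane d) :=
  {z | ∀ l ∈ Λ, ∀ h : TFSpace d → ℂ, MemLp h 2 volume →
    tfShift l (tfShift z h) =ᵐ[volume] tfShift z (tfShift l h)}

/-- Rihaczek's distribution `R(f, g)(x, ω) = f(x) conj(ĝ(ω)) e^{-2πi x·ω}`, where
`ĝ(ω) = ∫ g(t) e^{-2πi ω·t} dt`. -/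
def rihaczek {d : ℕ} (f g : TFSpace d → ℂ) (z : TFPlane d) : ℂ :=
  f z.1 * conj (𝓕 g z.2) *
    Complex.exp (-(2 * (Real.pi : ℂ) * Complex.I * ((inner ℝ z.1 z.2 : ℝ) : ℂ)))

end

open MeasureTheory
open scoped FourierTransform SchwartzMap ComplexConjugate

/-! ### Gaussian sums over lattices, with bounds uniform under translation. -/

section GaussianSums

/-! Both sides are sesquilinear in `(f, g)`, so it suffices to prove the formula for time-frequency
shifts of one Gaussian `γ` and then superpose. Inversion of the short-time Fourier transform writes
every `f` in `M^1` pointwise as `∫ F(z) π(z)γ dz` with `F` integrable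
(`MemFeichtingerAlgebra.exists_eq_integral_tfShift_gaussianWindow`).

For `A = π(z)γ` and `B = π(w)γ`, the symplectic Fourier transform of `V_B A` is `R(A, B)`
(`integral_stft_mul_exp_symplectic`). The commutation relations of the shifts show that `Λ⁰` is the
lattice dual to `Λ` under the symplectic form (`adjointLattice_eq_span`). The formula for this pair
is therefore Poisson summation (`ZLattice.tsum_eq_tsum_integral`), legitimate because both functions
have Gaussian decay.

Superposition needs bounds independent of `z` and `w`. The shifts only move the centres of the
Gaussian majorants, and sums of a translated Gaussian over a lattice are bounded uniformly in the
translation (`ZLattice.exists_forall_tsum_exp_neg_mul_sq_norm_sub_le`). Hence sums and integrals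
against `F ⊗ conj G` may be interchanged (`summable_norm_integral_mul_and_tsum_eq`), which also
yields absolute convergence. -/

theorem exp_neg_mul_sq_norm_sub_le {E : Type*} [NormedAddCommGroup E] {c : ℝ} (hc : 0 ≤ c)
    {M : ℝ} (u r : E) (hr : ‖r‖ ≤ M) :
    Real.exp (-c * ‖u - r‖ ^ 2) ≤ Real.exp (c * M ^ 2) * Real.exp (-(c / 2) * ‖u‖ ^ 2) := by
  rw [← Real.exp_add]
  apply Real.exp_le_exp.mpr
  have h1 : ‖u‖ ≤ ‖u - r‖ + ‖r‖ := by simpa using norm_add_le (u - r) r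
  have h2 : ‖u‖ ^ 2 ≤ 2 * ‖u - r‖ ^ 2 + 2 * M ^ 2 := by
    nlinarith [norm_nonneg u, norm_nonneg r, norm_nonneg (u - r), sq_nonneg (‖u - r‖ - ‖r‖)]
  nlinarith

variable {E : Type*} [NormedAddCommGroup E] [NormedSpace ℝ E] [FiniteDimensional ℝ E]
variable (L : Submodule ℤ E) [DiscreteTopology L] [IsZLattice ℝ L]

omit [IsZLattice ℝ L] in
theorem ZLattice.summable_exp_neg_mul_sq_norm {c : ℝ} (hc : 0 < c) :
    Summable fun l : L => Real.exp (-c * ‖(l : E)‖ ^ 2) := by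
  -- By `e^t ≥ t^n / n!`, the Gaussian is dominated by a multiple of `‖l‖^(-2n)`, and `2n` exceeds
  -- the rank. The comparison fails to make sense only at `l = 0`.
  set n := Module.finrank ℤ L + 1 with hn
  refine Summable.of_norm_bounded_eventually
    ((ZLattice.summable_norm_pow_inv L (2 * n) (by omega)).mul_left (n.factorial / c ^ n)) ?_
  refine (Set.finite_singleton (0 : L)).subset fun l hl => ?_
  by_contra hl0
  refine hl ?_
  have hl0 : l ≠ 0 := hl0
  have hpos : 0 < ‖l‖ := norm_pos_iff.mpr hl0
  have ht : 0 < c * ‖l‖ ^ 2 := by positivity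
  have := Real.pow_div_factorial_le_exp (c * ‖l‖ ^ 2) ht.le n
  rw [Set.mem_ofPred_eq, Real.norm_eq_abs, abs_of_pos (Real.exp_pos _), neg_mul, Real.exp_neg]
  calc (Real.exp (c * ‖(l : E)‖ ^ 2))⁻¹ ≤ ((c * ‖l‖ ^ 2) ^ n / n.factorial)⁻¹ := by
        gcongr
        exact this
    _ = _ := by
        rw [inv_div, mul_pow, ← pow_mul, inv_pow]
        field_simp

/-- Reindexing by the lattice part of `x` replaces `x` by its representative in a bounded
fundamental domain. A bounded shift costs only a constant factor and half the decay rate, so the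
centred sum dominates. -/
theorem ZLattice.exists_forall_tsum_exp_neg_mul_sq_norm_sub_le {c : ℝ} (hc : 0 < c) :
    ∃ C : ℝ, ∀ x : E, (Summable fun l : L => Real.exp (-c * ‖(l : E) - x‖ ^ 2)) ∧
      ∑' l : L, Real.exp (-c * ‖(l : E) - x‖ ^ 2) ≤ C := by
  let b := (Module.Free.chooseBasis ℤ L).ofZLatticeBasis ℝ L
  set M := ∑ i, ‖b i‖
  have hS := (ZLattice.summable_exp_neg_mul_sq_norm L (half_pos hc)).mul_left (Real.exp (c * M ^ 2))
  refine ⟨∑' l : L, Real.exp (c * M ^ 2) * Real.exp (-(c / 2) * ‖(l : E)‖ ^ 2), fun x => ?_⟩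
  have hv : (ZSpan.floor b x : E) ∈ L :=
    (Module.Basis.ofZLatticeBasis_span ℝ L _).le (ZSpan.floor b x).2
  let e : L ≃ L := Equiv.subRight ⟨ZSpan.floor b x, hv⟩
  have key : ∀ l : L, Real.exp (-c * ‖(l : E) - x‖ ^ 2) ≤
      Real.exp (c * M ^ 2) * Real.exp (-(c / 2) * ‖(e l : E)‖ ^ 2) := fun l => by
    have := exp_neg_mul_sq_norm_sub_le hc.le (e l : E) (ZSpan.fract b x) (ZSpan.norm_fract_le b x)
    convert this using 5
    simp [e, ZSpan.fract_apply]
  have hS' := e.summable_iff.mpr hS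
  have hs : Summable fun l : L => Real.exp (-c * ‖(l : E) - x‖ ^ 2) :=
    Summable.of_nonneg_of_le (fun _ => (Real.exp_pos _).le) key hS'
  refine ⟨hs, ?_⟩
  calc _ ≤ _ := hs.tsum_le_tsum key hS'
    _ = _ := e.tsum_eq (fun l : L => Real.exp (c * M ^ 2) * Real.exp (-(c / 2) * ‖(l : E)‖ ^ 2))

omit [IsZLattice ℝ L] in
theorem ZLattice.continuous_tsum_add {h : E → ℂ} (hh : Continuous h) {C c : ℝ} (hc : 0 < c) {a : E}
    (hdecay : ∀ u, ‖h u‖ ≤ C * Real.exp (-c * ‖u - a‖ ^ 2)) :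
    Continuous fun u => ∑' l : L, h (l + u) := by
  rw [continuous_iff_continuousAt]
  intro u₀
  set M := ‖u₀‖ + 1 + ‖a‖
  have hC : 0 ≤ C := by
    have := (norm_nonneg _).trans (hdecay a)
    simpa using this
  have hS := ((ZLattice.summable_exp_neg_mul_sq_norm L (half_pos hc)).mul_left
    (Real.exp (c * M ^ 2))).mul_left C
  have : ContinuousOn (fun u => ∑' l : L, h (l + u)) (Metric.ball u₀ 1) := by
    refine continuousOn_tsum (fun l => by fun_prop) hS fun l u hu => ?_
    refine (hdecay _).trans (mul_le_mul_of_nonneg_left ?_ hC)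
    rw [show (l : E) + u - a = l - (a - u) by abel]
    refine exp_neg_mul_sq_norm_sub_le hc.le (l : E) (M := M) (a - u) ?_
    · have h1 : ‖u - u₀‖ < 1 := by simpa [dist_eq_norm] using hu
      have h2 : ‖u‖ ≤ ‖u - u₀‖ + ‖u₀‖ := by simpa using norm_add_le (u - u₀) u₀
      have h3 := norm_sub_le a u
      simp only [M]; linarith
  exact this.continuousAt (Metric.ball_mem_nhds _ one_pos)

end GaussianSums

/-! ### Poisson summation over a lattice, by transfer to the standard torus. -/

section Poisson

variable {E : Type*} [NormedAddCommGroup E] [NormedSpace ℝ E] [FiniteDimensional ℝ E]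
variable [MeasurableSpace E] [BorelSpace E] (μ : Measure E) [μ.IsAddHaarMeasure]
variable (L : Submodule ℤ E) [DiscreteTopology L] [IsZLattice ℝ L]
variable {ι : Type*} [Fintype ι] (b : Module.Basis ι ℤ L)

/-- Both measures are Haar, hence proportional. The constant is read off on the fundamental domain,
whose preimage is the unit cube. -/
theorem ZLattice.map_equivFun_symm_volume :
    (volume : Measure (ι → ℝ)).map (b.ofZLatticeBasis ℝ L).equivFun.symm =
      (ENNReal.ofReal (covolume L μ))⁻¹ • μ := by
  set e := (b.ofZLatticeBasis ℝ L).equivFun.symm.toContinuousLinearEquiv with he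
  have : (volume.map e).IsAddHaarMeasure := e.isAddHaarMeasure_map volume
  have h := Measure.isAddLeftInvariant_eq_smul ((volume : Measure (ι → ℝ)).map e) μ
  set s := Measure.addHaarScalarFactor ((volume : Measure (ι → ℝ)).map e) μ
  have hF := ZLattice.isAddFundamentalDomain b μ
  set F := ZSpan.fundamentalDomain (b.ofZLatticeBasis ℝ L)
  have hmeas : MeasurableSet F := ZSpan.fundamentalDomain_measurableSet _
  have h1 : (volume : Measure (ι → ℝ)).map e F = 1 := by
    rw [Measure.map_apply e.continuous.measurable hmeas]
    have : e ⁻¹' F = Set.univ.pi fun _ => Set.Ico 0 1 := by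
      ext x
      have hx : ∀ i, (b.ofZLatticeBasis ℝ L).repr (e x) i = x i := fun i =>
        congrFun ((b.ofZLatticeBasis ℝ L).equivFun.apply_symm_apply x) i
      simp only [F, Set.mem_preimage, ZSpan.mem_fundamentalDomain, hx, Set.mem_univ_pi]
    rw [this, Real.volume_pi_Ico]
    simp
  have hfin : μ F ≠ ⊤ := (ZSpan.fundamentalDomain_isBounded _).measure_lt_top.ne
  have h2 : ENNReal.ofReal (covolume L μ) = μ F := by
    rw [covolume_eq_measure_fundamentalDomain L μ hF, Measure.real, ENNReal.ofReal_toReal hfin]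
  have h3 : (s : ENNReal) * μ F = 1 := by
    rw [← h1, h]; rfl
  change Measure.map e volume = _
  rw [h2, h, ← ENNReal.eq_inv_of_mul_eq_one_left h3]
  rfl

/-- The character `u ↦ e^{-2πi m·x}`, `x` being the coordinates of `u` in a basis of the lattice. -/
noncomputable def ZLattice.char (m : ι → ℤ) (u : E) : ℂ :=
  Complex.exp (-(2 * (Real.pi : ℂ) * Complex.I *
    ((∑ i, m i * (b.ofZLatticeBasis ℝ L).repr u i : ℝ) : ℂ)))

omit [MeasurableSpace E] [BorelSpace E] in
theorem ZLattice.continuous_char (m : ι → ℤ) : Continuous (ZLattice.char L b m) := by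
  have : ∀ i, Continuous fun u => (b.ofZLatticeBasis ℝ L).repr u i := fun i =>
    ((b.ofZLatticeBasis ℝ L).coord i).continuous_of_finiteDimensional
  unfold ZLattice.char
  fun_prop

omit [MeasurableSpace E] [BorelSpace E] in
theorem ZLattice.norm_char (m : ι → ℤ) (u : E) : ‖ZLattice.char L b m u‖ = 1 := by
  rw [ZLattice.char, Complex.norm_exp]
  simp

omit [MeasurableSpace E] [BorelSpace E] in
theorem ZLattice.char_add_left (m : ι → ℤ) (l : L) (u : E) :
    ZLattice.char L b m (l + u) = ZLattice.char L b m u := by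
  unfold ZLattice.char
  rw [Complex.exp_eq_exp_iff_exists_int]
  refine ⟨-∑ i, m i * b.repr l i, ?_⟩
  simp only [map_add, Finsupp.add_apply, Module.Basis.ofZLatticeBasis_repr_apply, mul_add,
    Finset.sum_add_distrib]
  push_cast
  ring

omit [MeasurableSpace E] [BorelSpace E] in
theorem ZLattice.char_equivFun_symm (m : ι → ℤ) (x : ι → ℝ) :
    ZLattice.char L b m ((b.ofZLatticeBasis ℝ L).equivFun.symm x) =
      UnitAddTorus.mFourier (-m) (fun i => (x i : UnitAddCircle)) := by
  have hx : ∀ i, (b.ofZLatticeBasis ℝ L).repr ((b.ofZLatticeBasis ℝ L).equivFun.symm x) i = x i :=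
    fun i => congrFun ((b.ofZLatticeBasis ℝ L).equivFun.apply_symm_apply x) i
  simp only [ZLattice.char, UnitAddTorus.mFourier, ContinuousMap.coe_mk, fourier_coe_apply, hx,
    ← Complex.exp_sum]
  congr 1
  push_cast
  rw [Finset.mul_sum, ← Finset.sum_neg_distrib]
  refine Finset.sum_congr rfl fun i _ => ?_
  simp
  ring

omit [FiniteDimensional ℝ E] [NormedSpace ℝ E] [DiscreteTopology L] [IsZLattice ℝ L] in
-- Unfolding: the lattice translates of a fundamental domain tile the space up to null sets.
theorem MeasureTheory.IsAddFundamentalDomain.setIntegral_tsum_add [Countable L] {F : Set E}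
    (hF : IsAddFundamentalDomain L F μ) {h : E → ℂ} (hh : Integrable h μ) :
    ∫ u in F, ∑' l : L, h (l + u) ∂μ = ∫ u, h u ∂μ := by
  have : MeasurableVAdd L E := (inferInstance : MeasurableVAdd L.toAddSubgroup E)
  have : VAddInvariantMeasure L E μ := (inferInstance : VAddInvariantMeasure L.toAddSubgroup E μ)
  rw [hF.integral_eq_tsum'' h hh]
  refine integral_tsum (fun l => ?_) ?_
  · exact (hh.1.comp_measurePreserving (measurePreserving_add_left μ (l : E))).restrict
  · have := hF.lintegral_eq_tsum'' (fun u => ‖h u‖ₑ)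
    exact (this.symm.trans_lt hh.2).ne

theorem ZLattice.setIntegral_pi_Ioc (P : E → ℂ) :
    ∫ x in {x : ι → ℝ | ∀ i, x i ∈ Set.Ioc (0 : ℝ) (0 + 1)},
        P ((b.ofZLatticeBasis ℝ L).equivFun.symm x) =
      ((covolume L μ : ℝ) : ℂ)⁻¹ *
        ∫ u in ZSpan.fundamentalDomain (b.ofZLatticeBasis ℝ L), P u ∂μ := by
  set B := b.ofZLatticeBasis ℝ L
  have hset : {x : ι → ℝ | ∀ i, x i ∈ Set.Ioc (0 : ℝ) (0 + 1)} =ᵐ[volume]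
      B.equivFun.symm ⁻¹' ZSpan.fundamentalDomain B := by
    have h1 : B.equivFun.symm ⁻¹' ZSpan.fundamentalDomain B =
        Set.univ.pi fun _ => Set.Ico (0 : ℝ) 1 := by
      ext x
      have hx : ∀ i, B.repr (B.equivFun.symm x) i = x i := fun i =>
        congrFun (B.equivFun.apply_symm_apply x) i
      simp only [Set.mem_preimage, ZSpan.mem_fundamentalDomain, hx, Set.mem_univ_pi]
    have h2 : {x : ι → ℝ | ∀ i, x i ∈ Set.Ioc (0 : ℝ) (0 + 1)} =
        Set.univ.pi fun _ => Set.Ioc (0 : ℝ) 1 := by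
      ext x
      simp
    rw [h1, h2]
    exact (Measure.univ_pi_Ioc_ae_eq_Icc (μ := fun _ : ι => (volume : Measure ℝ))
      (f := fun _ => 0) (g := fun _ => 1)).trans (Measure.univ_pi_Ico_ae_eq_Icc).symm
  rw [setIntegral_congr_set hset]
  have hmap := ZLattice.map_equivFun_symm_volume μ L b
  have hemb : MeasurableEmbedding B.equivFun.symm :=
    B.equivFun.symm.toContinuousLinearEquiv.toHomeomorph.measurableEmbedding
  rw [← hemb.setIntegral_map, hmap, Measure.restrict_smul, integral_smul_measure,
    ENNReal.toReal_inv, ENNReal.toReal_ofReal (covolume_pos L μ).le, Complex.real_smul,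
    Complex.ofReal_inv]

/-- The periodization of `h` descends to a continuous function on the torus, with Fourier
coefficients given by unfolding. Since these are summable, the Fourier series converges pointwise,
and evaluating it at `0` gives the identity. -/
theorem ZLattice.tsum_eq_tsum_integral {h : E → ℂ} (hh : Continuous h) (hint : Integrable h μ)
    {C c : ℝ} (hc : 0 < c) {a : E} (hdecay : ∀ u, ‖h u‖ ≤ C * Real.exp (-c * ‖u - a‖ ^ 2))
    (hsum : Summable fun m : ι → ℤ => ∫ u, ZLattice.char L b m u * h u ∂μ) :
    ∑' l : L, h l = ((covolume L μ : ℝ) : ℂ)⁻¹ *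
      ∑' m : ι → ℤ, ∫ u, ZLattice.char L b m u * h u ∂μ := by
  classical
  set T := (b.ofZLatticeBasis ℝ L).equivFun.symm with hT
  set P : E → ℂ := fun u => ∑' l : L, h (l + u) with hP
  have hPc : Continuous P := ZLattice.continuous_tsum_add L hh hc hdecay
  have hPper : ∀ (l : L) u, P (l + u) = P u := fun l u => by
    simp only [hP]
    rw [← (Equiv.addRight l).tsum_eq (fun k : L => h (k + u))]
    simp [add_assoc]
  let q : (ι → ℝ) → UnitAddTorus ι := fun x i => (x i : UnitAddCircle)
  have hq : IsOpenQuotientMap q :=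
    IsOpenQuotientMap.piMap fun _ => QuotientAddGroup.isOpenQuotientMap_mk
  -- An arbitrary section of the quotient map serves here; periodicity of `P` makes its choice
  -- irrelevant (`hHq`).
  let H : UnitAddTorus ι → ℂ := fun y => P (T (Function.surjInv hq.surjective y))
  have hTint : ∀ k : ι → ℤ, T (fun i => (k i : ℝ)) ∈ L := fun k => by
    rw [hT, Module.Basis.equivFun_symm_apply]
    refine Submodule.sum_mem _ fun i _ => ?_
    rw [Module.Basis.ofZLatticeBasis_apply, Int.cast_smul_eq_zsmul]
    exact L.smul_mem _ (b i).2
  have hHq : ∀ x, H (q x) = P (T x) := fun x => by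
    have h1 : q (Function.surjInv hq.surjective (q x)) = q x :=
      Function.surjInv_eq hq.surjective (q x)
    set x' := Function.surjInv hq.surjective (q x)
    have h2 : ∀ i, ∃ n : ℤ, (n : ℝ) = x' i - x i := fun i => by
      have h3 := congrFun h1 i
      have h5 : ((x' i - x i : ℝ) : UnitAddCircle) = 0 := by
        rw [AddCircle.coe_sub, sub_eq_zero]
        exact h3
      obtain ⟨n, hn⟩ := (AddCircle.coe_eq_zero_iff 1).mp h5
      exact ⟨n, by simpa using hn⟩
    choose k hk using h2
    have h4 : x' = (fun i => (k i : ℝ)) + x := by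
      ext i; simp [hk]
    change P (T x') = _
    rw [h4, map_add]
    exact hPper ⟨_, hTint k⟩ _
  have hHc : Continuous H := by
    rw [hq.isQuotientMap.continuous_iff]
    have : H ∘ q = P ∘ T := funext hHq
    rw [this]
    exact hPc.comp T.toContinuousLinearEquiv.continuous
  have hcoef : ∀ m, UnitAddTorus.mFourierCoeff H m =
      ((covolume L μ : ℝ) : ℂ)⁻¹ * ∫ u, ZLattice.char L b m u * h u ∂μ := fun m => by
    rw [UnitAddTorus.mFourierCoeff_eq_integral _ _ 0]
    have h1 : ∀ x : ι → ℝ, UnitAddTorus.mFourier (-m) (q x) • H (q x) =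
        (fun u => ∑' l : L, ZLattice.char L b m (l + u) * h (l + u)) (T x) := fun x => by
      simp only [ZLattice.char_add_left, tsum_mul_left, hHq, smul_eq_mul]
      rw [ZLattice.char_equivFun_symm]
    have hF := ZLattice.isAddFundamentalDomain b μ
    have : Countable L := inferInstance
    rw [← hF.setIntegral_tsum_add μ L (h := fun u => ZLattice.char L b m u * h u),
      ← ZLattice.setIntegral_pi_Ioc]
    · exact integral_congr_ae (Filter.Eventually.of_forall h1)
    · exact hint.bdd_mul (c := 1) (ZLattice.continuous_char L b m).aestronglyMeasurable
        (Filter.Eventually.of_forall fun u => (ZLattice.norm_char L b m u).le)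
  have hs : Summable (UnitAddTorus.mFourierCoeff H) := by
    simp only [funext hcoef]
    exact hsum.mul_left _
  have hmain := (UnitAddTorus.hasSum_mFourier_series_apply_of_summable
    (f := ⟨H, hHc⟩) hs (q 0)).tsum_eq
  have h0 : ∀ m, UnitAddTorus.mFourier m (q 0) = 1 := fun m => by
    simp [UnitAddTorus.mFourier, q]
  have h5 : H (q 0) = ∑' l : L, h l := by simp [hHq, hP]
  simp only [ContinuousMap.coe_mk, h0, smul_eq_mul, mul_one, hcoef, tsum_mul_left, h5] at hmain
  exact hmain.symm

end Poisson

/-! ### The Gaussian window. -/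

section Gaussian

variable {d : ℕ}

/-- The Gaussian window `e^{-π|t|²}`. -/
noncomputable def gaussianWindow (d : ℕ) (t : TFSpace d) : ℂ :=
  Complex.exp (-(Real.pi : ℂ) * (‖t‖ : ℂ) ^ 2)

theorem continuous_gaussianWindow : Continuous (gaussianWindow d) := by
  unfold gaussianWindow
  fun_prop

theorem norm_gaussianWindow (t : TFSpace d) :
    ‖gaussianWindow d t‖ = Real.exp (-Real.pi * ‖t‖ ^ 2) := by
  rw [gaussianWindow, Complex.norm_exp]
  congr 1
  norm_cast

theorem norm_gaussianWindow_le_one (t : TFSpace d) : ‖gaussianWindow d t‖ ≤ 1 := by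
  rw [norm_gaussianWindow, Real.exp_le_one_iff]
  have := Real.pi_pos
  have := sq_nonneg ‖t‖
  nlinarith

theorem gaussianWindow_ne_zero (t : TFSpace d) : gaussianWindow d t ≠ 0 := Complex.exp_ne_zero _

theorem conj_gaussianWindow (t : TFSpace d) : conj (gaussianWindow d t) = gaussianWindow d t := by
  rw [gaussianWindow, ← Complex.exp_conj]
  simp

theorem integrable_gaussianWindow : Integrable (gaussianWindow d) := by
  have := GaussianFourier.integrable_cexp_neg_mul_sq_norm_add (V := TFSpace d)
    (b := (Real.pi : ℂ)) (by simpa using Real.pi_pos) 0 0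
  simpa [funext fun t => gaussianWindow.eq_1 d t] using this

end Gaussian

/-! ### Time-frequency shifts and the short-time Fourier transform as a Fourier transform. -/

section Shifts

variable {d : ℕ}

theorem norm_exp_neg_two_pi_I_mul (r : ℝ) :
    ‖Complex.exp (-(2 * (Real.pi : ℂ) * Complex.I * (r : ℂ)))‖ = 1 := by
  rw [Complex.norm_exp]; simp

theorem norm_exp_two_pi_I_mul (r : ℝ) :
    ‖Complex.exp (2 * (Real.pi : ℂ) * Complex.I * (r : ℂ))‖ = 1 := by
  rw [Complex.norm_exp]; simp

theorem norm_tfShift (z : TFPlane d) (h : TFSpace d → ℂ) (t : TFSpace d) :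
    ‖tfShift z h t‖ = ‖h (t - z.1)‖ := by
  rw [tfShift, norm_mul, norm_exp_two_pi_I_mul, one_mul]

theorem continuous_tfShift {h : TFSpace d → ℂ} (hh : Continuous h) (z : TFPlane d) :
    Continuous (tfShift z h) := by
  unfold tfShift
  fun_prop

theorem stft_eq_fourier (g f : TFSpace d → ℂ) (z : TFPlane d) :
    stft g f z = 𝓕 (fun t => f t * conj (g (t - z.1))) z.2 := by
  rw [Real.fourier_eq', stft]
  congr 1 with t
  rw [smul_eq_mul, mul_comm, real_inner_comm]
  congr 2
  push_cast
  ring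

/-- For fixed `x` this is Fourier inversion in `ω`; continuity makes it valid at every `t`. -/
theorem integral_stft_mul_exp {f g : TFSpace d → ℂ} (hf : Continuous f) (hg : Continuous g)
    {x : TFSpace d} (hfg : Integrable fun t => f t * conj (g (t - x)))
    (hV : Integrable fun ω => stft g f (x, ω)) (t : TFSpace d) :
    ∫ ω, stft g f (x, ω) *
      Complex.exp (2 * (Real.pi : ℂ) * Complex.I * ((inner ℝ ω t : ℝ) : ℂ)) =
      f t * conj (g (t - x)) := by
  simp only [stft_eq_fourier] at hV ⊢
  have := congrFun (Continuous.fourierInv_fourier_eq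
    (f := fun t => f t * conj (g (t - x))) (by fun_prop) hfg hV) t
  rw [← this, Real.fourierInv_eq']
  congr 1 with ω
  rw [smul_eq_mul, mul_comm]
  congr 2
  push_cast
  ring

theorem MemFeichtingerAlgebra.integrable_mul_conj {f : TFSpace d → ℂ}
    (hf : MemFeichtingerAlgebra f) (φ : 𝓢(TFSpace d, ℂ)) (x : TFSpace d) :
    Integrable fun t => f t * conj (φ (t - x)) := by
  have hfc := hf.continuous
  refine (hf.tempered (SchwartzMap.compSubConstCLM ℂ x φ)).mono
    (Continuous.aestronglyMeasurable (by fun_prop)) (Filter.Eventually.of_forall fun t => ?_)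
  simp

/-- If all these pairings vanished, the Fourier transform of `conj φ · γ` would be zero, hence `φ =
0` because `γ` has no zeros. The nonzero value is the normalizing constant of the reconstruction
formula; `γ` itself might be orthogonal to `φ`. -/
theorem exists_integral_modulation_mul_conj_ne_zero {φ : 𝓢(TFSpace d, ℂ)} (hφ : φ ≠ 0) :
    ∃ a : TFSpace d, ∫ s, conj (φ s) * tfShift (0, a) (gaussianWindow d) s ≠ 0 := by
  by_contra! h
  apply hφ
  set q : TFSpace d → ℂ := fun s => conj (φ s) * gaussianWindow d s
  have hqc : Continuous q := by
    have := continuous_gaussianWindow (d := d)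
    have := φ.continuous
    fun_prop
  have hq : Integrable q :=
    (φ.integrable (μ := volume)).mono hqc.aestronglyMeasurable (Filter.Eventually.of_forall fun s => by
      simpa only [q, norm_mul, RCLike.norm_conj] using
        mul_le_of_le_one_right (norm_nonneg _) (norm_gaussianWindow_le_one s))
  have hF : 𝓕 q = 0 := by
    ext a
    rw [Real.fourier_eq', Pi.zero_apply, ← h (-a)]
    congr 1 with s
    simp only [tfShift, q, sub_zero, smul_eq_mul, inner_neg_left]
    rw [real_inner_comm]
    push_cast
    ring_nf
  have hinv := hqc.fourierInv_fourier_eq hq (by rw [hF]; exact integrable_zero _ _ _)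
  ext s
  have hs := congrFun hinv s
  rw [hF, Real.fourierInv_eq'] at hs
  simpa [q, gaussianWindow_ne_zero] using hs.symm

end Shifts

/-! ### Elements of `M^1` as superpositions of shifted Gaussians. -/

section Reconstruction

variable {d : ℕ}

instance isAddHaarMeasure_volume_TFPlane : (volume : Measure (TFPlane d)).IsAddHaarMeasure :=
  inferInstanceAs ((volume : Measure (TFSpace d)).prod volume).IsAddHaarMeasure

theorem tfShift_add_snd (z : TFPlane d) (a : TFSpace d) (h : TFSpace d → ℂ) (t : TFSpace d) :
    Complex.exp (-(2 * (Real.pi : ℂ) * Complex.I * ((inner ℝ a z.1 : ℝ) : ℂ))) *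
        tfShift (z + (0, a)) h t =
      Complex.exp (2 * (Real.pi : ℂ) * Complex.I * ((inner ℝ z.2 t : ℝ) : ℂ)) *
        tfShift (0, a) h (t - z.1) := by
  simp only [tfShift, Prod.fst_add, Prod.snd_add, add_zero, sub_zero, ← mul_assoc,
    ← Complex.exp_add, inner_add_left, inner_sub_right]
  congr 2
  push_cast
  ring

/-- The inversion formula `c f = ∫ V_φ f(z) π(z)ψ dz`, with analysis window `φ`, synthesis window `ψ
= π(0, a)γ` and `c = ∫ conj φ · ψ ≠ 0`. The `ω`-integral recovers `f(t) conj φ(t - x)`, and the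
`x`-integral then produces `c f(t)`. -/
theorem MemFeichtingerAlgebra.exists_eq_integral_tfShift_gaussianWindow {f : TFSpace d → ℂ}
    (hf : MemFeichtingerAlgebra f) :
    ∃ F : TFPlane d → ℂ, Integrable F ∧
      ∀ t, f t = ∫ z, F z * tfShift z (gaussianWindow d) t := by
  obtain ⟨φ, hφ, hV⟩ := hf.integrable_stft
  obtain ⟨a, hc⟩ := exists_integral_modulation_mul_conj_ne_zero hφ
  set ψ := tfShift (0, a) (gaussianWindow d)
  set c := ∫ s, conj (φ s) * ψ s
  set V := stft (fun t => φ t) f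
  have hφc := φ.continuous
  have hψc : Continuous ψ := continuous_tfShift continuous_gaussianWindow _
  let F₀ : TFPlane d → ℂ := fun z => c⁻¹ * V z *
    Complex.exp (-(2 * (Real.pi : ℂ) * Complex.I * ((inner ℝ a z.1 : ℝ) : ℂ)))
  have hF₀ : Integrable F₀ :=
    (hV.const_mul c⁻¹).mul_bdd (c := 1) (Continuous.aestronglyMeasurable (by fun_prop))
      (Filter.Eventually.of_forall fun z => (norm_exp_neg_two_pi_I_mul _).le)
  -- Translating by `(0, a)` absorbs the modulation in `ψ`, so only shifts of `γ` itself appear; the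
  -- phase in `F₀` corrects for composing the two shifts.
  refine ⟨fun z => F₀ (z - (0, a)), hF₀.comp_sub_right _, fun t => ?_⟩
  rw [← integral_add_right_eq_self _ ((0, a) : TFPlane d)]
  have h1 : ∀ z : TFPlane d, F₀ (z + (0, a) - (0, a)) *
      tfShift (z + (0, a)) (gaussianWindow d) t =
      c⁻¹ * (V z * Complex.exp (2 * (Real.pi : ℂ) * Complex.I * ((inner ℝ z.2 t : ℝ) : ℂ)) *
        ψ (t - z.1)) := fun z => by
    simp only [add_sub_cancel_right, F₀, ψ]
    rw [mul_assoc, tfShift_add_snd]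
    ring
  simp only [h1]
  have hint : Integrable fun z : TFPlane d =>
      V z * Complex.exp (2 * (Real.pi : ℂ) * Complex.I * ((inner ℝ z.2 t : ℝ) : ℂ)) *
        ψ (t - z.1) := by
    refine (hV.mul_bdd (c := 1) (Continuous.aestronglyMeasurable (by fun_prop))
      (Filter.Eventually.of_forall fun z => (norm_exp_two_pi_I_mul _).le)).mul_bdd (c := 1)
      (Continuous.aestronglyMeasurable (by fun_prop)) (Filter.Eventually.of_forall fun z => ?_)
    rw [norm_tfShift]
    exact norm_gaussianWindow_le_one _
  rw [integral_const_mul, Measure.volume_eq_prod, integral_prod _ hint]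
  have h2 : ∀ᵐ x : TFSpace d, ∫ ω : TFSpace d, V (x, ω) *
      Complex.exp (2 * (Real.pi : ℂ) * Complex.I * ((inner ℝ ω t : ℝ) : ℂ)) * ψ (t - x) =
      f t * (conj (φ (t - x)) * ψ (t - x)) := by
    have hV' : Integrable V (volume.prod volume) := hV
    filter_upwards [hV'.prod_right_ae] with x hx
    rw [integral_mul_const, integral_stft_mul_exp hf.continuous hφc (hf.integrable_mul_conj φ x) hx]
    ring
  rw [integral_congr_ae h2, integral_const_mul,
    integral_sub_left_eq_self (fun s => conj (φ s) * ψ s) volume t]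
  change f t = c⁻¹ * (f t * c)
  field_simp

end Reconstruction

/-! ### The Rihaczek distribution as a symplectic Fourier transform. -/

section Rihaczek

variable {d : ℕ}

/-- Inverting the Fourier transform in `ω` gives `A(z₁) conj B(z₁ - x)`; the remaining integral over
`x` is a conjugated Fourier transform of `B`, up to the phase in `R`. -/
theorem integral_stft_mul_exp_symplectic {A B : TFSpace d → ℂ} (hA : Continuous A)
    (hB : Continuous B) (hAB : ∀ x, Integrable fun t => A t * conj (B (t - x)))
    (hV : Integrable (stft B A)) (z : TFPlane d) :
    ∫ l : TFPlane d, Complex.exp (-(2 * (Real.pi : ℂ) * Complex.I *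
        ((inner ℝ z.2 l.1 - inner ℝ l.2 z.1 : ℝ) : ℂ))) * stft B A l = rihaczek A B z := by
  have hV' : Integrable (stft B A) (volume.prod volume) := hV
  have hint : Integrable (fun l : TFPlane d => Complex.exp (-(2 * (Real.pi : ℂ) * Complex.I *
        ((inner ℝ z.2 l.1 - inner ℝ l.2 z.1 : ℝ) : ℂ))) * stft B A l) (volume.prod volume) :=
    hV'.bdd_mul (c := 1) (Continuous.aestronglyMeasurable (by fun_prop))
      (Filter.Eventually.of_forall fun l => (norm_exp_neg_two_pi_I_mul _).le)
  rw [Measure.volume_eq_prod, integral_prod _ hint]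
  have h2 : ∀ᵐ x : TFSpace d, ∫ ω : TFSpace d, Complex.exp (-(2 * (Real.pi : ℂ) * Complex.I *
        ((inner ℝ z.2 x - inner ℝ ω z.1 : ℝ) : ℂ))) * stft B A (x, ω) =
      A z.1 * (conj (B (z.1 - x)) *
        Complex.exp (-(2 * (Real.pi : ℂ) * Complex.I * ((inner ℝ z.2 x : ℝ) : ℂ)))) := by
    filter_upwards [hV'.prod_right_ae] with x hx
    rw [← mul_assoc (A z.1), ← integral_stft_mul_exp hA hB (hAB x) hx, ← integral_mul_const]
    congr 1 with ω
    rw [mul_comm, mul_assoc (stft B A (x, ω)), ← Complex.exp_add]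
    congr 2
    push_cast
    ring
  rw [integral_congr_ae h2, integral_const_mul, rihaczek, mul_assoc (A z.1)]
  congr 1
  rw [← integral_sub_left_eq_self _ volume z.1, Real.fourier_eq', ← integral_conj,
    ← integral_mul_const]
  congr 1 with s
  simp only [sub_sub_cancel, smul_eq_mul, map_mul, ← Complex.exp_conj]
  rw [mul_comm, mul_right_comm _ (conj (B s)), ← Complex.exp_add]
  congr 2
  simp only [Complex.conj_ofReal, Complex.conj_I, inner_sub_right]
  rw [real_inner_comm z.1 z.2, real_inner_comm s z.2]
  push_cast
  ring

end Rihaczek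

/-! ### Explicit short-time Fourier transforms of shifted Gaussians. -/

section GaussianKernel

variable {d : ℕ}

theorem integral_gaussianWindow_mul (a b η : TFSpace d) :
    ∫ t, gaussianWindow d (t - a) * gaussianWindow d (t - b) *
        Complex.exp (-(2 * (Real.pi : ℂ) * Complex.I * ((inner ℝ η t : ℝ) : ℂ))) =
      (1 / 2 : ℂ) ^ (d / 2 : ℂ) *
        Complex.exp (-((Real.pi * Complex.I * ((inner ℝ η (a + b) : ℝ) : ℂ)))) *
        (Real.exp (-(Real.pi / 2) * ‖a - b‖ ^ 2 - Real.pi / 2 * ‖η‖ ^ 2) : ℝ) := by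
  have hpi : (Real.pi : ℂ) ≠ 0 := by exact_mod_cast Real.pi_ne_zero
  -- Centring at the midpoint of `a` and `b` makes the product a single Gaussian in `t`, by the
  -- parallelogram identity (`e3`).
  rw [← integral_add_right_eq_self _ ((1 / 2 : ℝ) • (a + b))]
  have h := GaussianFourier.integral_cexp_neg_mul_sq_norm_add (V := TFSpace d)
    (b := (2 * Real.pi : ℂ)) (by simpa using Real.pi_pos) (-(2 * (Real.pi : ℂ) * Complex.I)) η
  rw [finrank_euclideanSpace_fin, show (Real.pi : ℂ) / (2 * Real.pi) = 1 / 2 by field_simp] at h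
  have hexp : ∀ t : TFSpace d,
      gaussianWindow d (t + (1 / 2 : ℝ) • (a + b) - a) *
        gaussianWindow d (t + (1 / 2 : ℝ) • (a + b) - b) *
        Complex.exp (-(2 * (Real.pi : ℂ) * Complex.I *
          ((inner ℝ η (t + (1 / 2 : ℝ) • (a + b)) : ℝ) : ℂ))) =
      Complex.exp (-(2 * Real.pi) * ‖t‖ ^ 2 + -(2 * (Real.pi : ℂ) * Complex.I) * (inner ℝ η t : ℝ)) *
      (Complex.exp (-((Real.pi * Complex.I * ((inner ℝ η (a + b) : ℝ) : ℂ)))) *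
        Complex.exp ((-(Real.pi / 2) * ‖a - b‖ ^ 2 : ℝ) : ℂ)) := fun t => by
    simp only [gaussianWindow, ← Complex.exp_add]
    congr 1
    have e1 : t + (1 / 2 : ℝ) • (a + b) - a = t - (1 / 2 : ℝ) • (a - b) := by module
    have e2 : t + (1 / 2 : ℝ) • (a + b) - b = t + (1 / 2 : ℝ) • (a - b) := by module
    have e3 : ‖t - (1 / 2 : ℝ) • (a - b)‖ ^ 2 + ‖t + (1 / 2 : ℝ) • (a - b)‖ ^ 2 =
        2 * ‖t‖ ^ 2 + (1 / 2) * ‖a - b‖ ^ 2 := by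
      rw [norm_sub_sq_real, norm_add_sq_real, norm_smul]
      norm_num
      ring
    have e3' := congrArg (fun r : ℝ => (r : ℂ)) e3
    rw [e1, e2, inner_add_right, inner_smul_right]
    push_cast at e3' ⊢
    linear_combination (-(Real.pi : ℂ)) * e3'
  simp only [hexp]
  rw [integral_mul_const, h, sub_eq_add_neg _ (Real.pi / 2 * ‖η‖ ^ 2), Real.exp_add]
  push_cast
  have : (-(2 * (Real.pi : ℂ) * Complex.I)) ^ 2 * (‖η‖ : ℂ) ^ 2 / (4 * (2 * Real.pi)) =
      -(Real.pi / 2 * ‖η‖ ^ 2) := by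
    rw [neg_sq, mul_pow, Complex.I_sq]
    field_simp
    ring
  rw [this]
  ring

theorem stft_tfShift_gaussianWindow (z w l : TFPlane d) :
    stft (tfShift w (gaussianWindow d)) (tfShift z (gaussianWindow d)) l =
      Complex.exp (2 * (Real.pi : ℂ) * Complex.I * ((inner ℝ w.2 l.1 : ℝ) : ℂ)) *
      ((1 / 2 : ℂ) ^ (d / 2 : ℂ) *
        Complex.exp (-((Real.pi * Complex.I *
          ((inner ℝ (l.2 + w.2 - z.2) (z.1 + (l.1 + w.1)) : ℝ) : ℂ)))) *
        (Real.exp (-(Real.pi / 2) * ‖z.1 - (l.1 + w.1)‖ ^ 2 -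
          Real.pi / 2 * ‖l.2 + w.2 - z.2‖ ^ 2) : ℝ)) := by
  rw [← integral_gaussianWindow_mul, ← integral_const_mul, stft]
  congr 1 with t
  simp only [tfShift, map_mul, conj_gaussianWindow, ← Complex.exp_conj, Complex.conj_ofReal,
    Complex.conj_I, map_ofNat, sub_sub]
  have : ∀ p q r g₁ g₂ : ℂ, Complex.exp p * g₁ * (Complex.exp q * g₂) * Complex.exp r =
      g₁ * g₂ * Complex.exp (p + q + r) := fun p q r g₁ g₂ => by
    rw [Complex.exp_add, Complex.exp_add]; ring
  rw [this, mul_left_comm, ← Complex.exp_add]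
  congr 2
  simp only [inner_sub_left, inner_add_left, inner_sub_right]
  push_cast
  ring

theorem continuous_stft_tfShift_gaussianWindow :
    Continuous fun p : (TFPlane d × TFPlane d) × TFPlane d =>
      stft (tfShift p.1.2 (gaussianWindow d)) (tfShift p.1.1 (gaussianWindow d)) p.2 := by
  simp only [stft_tfShift_gaussianWindow]
  fun_prop

theorem norm_stft_tfShift_gaussianWindow_le (z w l : TFPlane d) :
    ‖stft (tfShift w (gaussianWindow d)) (tfShift z (gaussianWindow d)) l‖ ≤
      Real.exp (-(Real.pi / 2) * ‖l.1 - (z.1 - w.1)‖ ^ 2) *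
        Real.exp (-(Real.pi / 2) * ‖l.2 - (z.2 - w.2)‖ ^ 2) := by
  rw [stft_tfShift_gaussianWindow, norm_mul, norm_exp_two_pi_I_mul, one_mul, norm_mul, norm_mul,
    Complex.norm_real, Real.norm_of_nonneg (Real.exp_pos _).le, ← Real.exp_add]
  have h1 : ‖Complex.exp (-((Real.pi * Complex.I *
      ((inner ℝ (l.2 + w.2 - z.2) (z.1 + (l.1 + w.1)) : ℝ) : ℂ))))‖ = 1 := by
    rw [Complex.norm_exp]; simp
  have h2 : ‖(1 / 2 : ℂ) ^ (d / 2 : ℂ)‖ ≤ 1 := by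
    rw [show (1 / 2 : ℂ) = ((1 / 2 : ℝ) : ℂ) by push_cast; rfl,
      Complex.norm_cpow_eq_rpow_re_of_pos (by norm_num)]
    refine Real.rpow_le_one (by norm_num) (by norm_num) ?_
    rw [show (d / 2 : ℂ) = ((d / 2 : ℝ) : ℂ) by push_cast; rfl, Complex.ofReal_re]
    positivity
  rw [h1, mul_one]
  refine (mul_le_of_le_one_left (Real.exp_pos _).le h2).trans (le_of_eq ?_)
  rw [show z.1 - (l.1 + w.1) = -(l.1 - (z.1 - w.1)) by abel, norm_neg,
    show l.2 + w.2 - z.2 = l.2 - (z.2 - w.2) by abel]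
  congr 1
  ring

/-- The norm on the plane is the maximum of the two component norms, so its square is at most the
sum of their squares. -/
theorem exp_mul_exp_neg_sq_norm_le {c : ℝ} (hc : 0 ≤ c) (z : TFPlane d) :
    Real.exp (-c * ‖z.1‖ ^ 2) * Real.exp (-c * ‖z.2‖ ^ 2) ≤ Real.exp (-c * ‖z‖ ^ 2) := by
  rw [← Real.exp_add, Real.exp_le_exp, Prod.norm_def]
  rcases max_cases ‖z.1‖ ‖z.2‖ with ⟨h, -⟩ | ⟨h, -⟩ <;> rw [h]
  · nlinarith [mul_nonneg hc (sq_nonneg ‖z.2‖)]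
  · nlinarith [mul_nonneg hc (sq_nonneg ‖z.1‖)]

theorem integrable_exp_neg_mul_sq_norm {c : ℝ} (hc : 0 < c) :
    Integrable fun t : TFSpace d => Real.exp (-c * ‖t‖ ^ 2) := by
  have := (GaussianFourier.integrable_cexp_neg_mul_sq_norm_add (V := TFSpace d)
    (b := (c : ℂ)) (by simpa using hc) 0 0).norm
  refine this.congr (Filter.Eventually.of_forall fun t => ?_)
  dsimp only
  rw [Complex.norm_exp]
  congr 1
  simp only [zero_mul, add_zero]
  norm_cast

theorem integrable_stft_tfShift_gaussianWindow (z w : TFPlane d) :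
    Integrable (stft (tfShift w (gaussianWindow d)) (tfShift z (gaussianWindow d))) := by
  have hc : 0 < Real.pi / 2 := by positivity
  refine ((((integrable_exp_neg_mul_sq_norm hc).comp_sub_right (z.1 - w.1)).mul_prod
    ((integrable_exp_neg_mul_sq_norm hc).comp_sub_right (z.2 - w.2)))).mono' ?_
    (Filter.Eventually.of_forall (norm_stft_tfShift_gaussianWindow_le z w))
  exact (continuous_stft_tfShift_gaussianWindow.comp
    (Continuous.prodMk_right (z, w))).aestronglyMeasurable

end GaussianKernel

/-! ### The adjoint lattice as the symplectic dual. -/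

section Adjoint

variable {d : ℕ}

/-- The symplectic form `(z, l) ↦ z₂·l₁ - l₂·z₁` on the time-frequency plane. -/
noncomputable def symplecticForm (d : ℕ) : TFPlane d →ₗ[ℝ] TFPlane d →ₗ[ℝ] ℝ :=
  LinearMap.mk₂ ℝ (fun z l => inner ℝ z.2 l.1 - inner ℝ l.2 z.1)
    (fun _ _ _ => by simp only [Prod.fst_add, Prod.snd_add, inner_add_left, inner_add_right]; ring)
    (fun _ _ _ => by
      simp only [Prod.smul_fst, Prod.smul_snd, inner_smul_left, inner_smul_right, smul_eq_mul,
        conj_trivial]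
      ring)
    (fun _ _ _ => by simp only [Prod.fst_add, Prod.snd_add, inner_add_left, inner_add_right]; ring)
    (fun _ _ _ => by
      simp only [Prod.smul_fst, Prod.smul_snd, inner_smul_left, inner_smul_right, smul_eq_mul,
        conj_trivial]
      ring)

theorem symplecticForm_apply (z l : TFPlane d) :
    symplecticForm d z l = inner ℝ z.2 l.1 - inner ℝ l.2 z.1 := rfl

theorem eq_zero_of_symplecticForm_eq_zero {z : TFPlane d} (h : symplecticForm d z = 0) : z = 0 := by
  have h1 := DFunLike.congr_fun h (z.2, 0)
  have h2 := DFunLike.congr_fun h (0, z.1)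
  simp only [symplecticForm_apply, inner_zero_left, sub_zero, LinearMap.zero_apply,
    inner_self_eq_zero, inner_zero_right, zero_sub, neg_eq_zero] at h1 h2
  exact Prod.ext h2 h1

theorem tfShift_tfShift (z l : TFPlane d) (h : TFSpace d → ℂ) (t : TFSpace d) :
    tfShift l (tfShift z h) t =
      Complex.exp (-(2 * (Real.pi : ℂ) * Complex.I * ((symplecticForm d z l : ℝ) : ℂ))) *
        tfShift z (tfShift l h) t := by
  simp only [tfShift, symplecticForm_apply, ← mul_assoc, ← Complex.exp_add, inner_sub_right,
    sub_right_comm]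
  congr 2
  push_cast
  ring

theorem memLp_two_gaussianWindow : MemLp (gaussianWindow d) 2 := by
  rw [memLp_two_iff_integrable_sq_norm continuous_gaussianWindow.aestronglyMeasurable]
  refine (integrable_exp_neg_mul_sq_norm (c := 2 * Real.pi) (by positivity)).congr
    (Filter.Eventually.of_forall fun t => ?_)
  simp only [norm_gaussianWindow, ← Real.exp_nat_mul]
  congr 1
  push_cast
  ring

theorem exp_neg_two_pi_I_mul_eq_one_iff {r : ℝ} :
    Complex.exp (-(2 * (Real.pi : ℂ) * Complex.I * (r : ℂ))) = 1 ↔ ∃ n : ℤ, (n : ℝ) = r := by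
  rw [Complex.exp_eq_one_iff]
  have hne : 2 * (Real.pi : ℂ) * Complex.I ≠ 0 := Complex.two_pi_I_ne_zero
  constructor
  · rintro ⟨n, hn⟩
    refine ⟨-n, ?_⟩
    have : 2 * (Real.pi : ℂ) * Complex.I * (-n - r) = 0 := by linear_combination hn
    have := (mul_eq_zero.mp this).resolve_left hne
    have h2 : ((-n : ℝ) : ℂ) = (r : ℂ) := by push_cast; exact sub_eq_zero.mp this
    exact_mod_cast h2
  · rintro ⟨n, rfl⟩
    exact ⟨-n, by push_cast; ring⟩

/-- The two orders of composition differ by the scalar `e^{-2πi σ(z,l)}`, where `σ` is the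
symplectic form. Testing on the nowhere vanishing Gaussian forces this scalar to be `1`. -/
theorem mem_adjointLattice_iff {Λ : Set (TFPlane d)} {z : TFPlane d} :
    z ∈ adjointLattice Λ ↔ ∀ l ∈ Λ, ∃ n : ℤ, (n : ℝ) = symplecticForm d z l := by
  refine forall₂_congr fun l _ => ?_
  rw [← exp_neg_two_pi_I_mul_eq_one_iff]
  constructor
  · intro h
    obtain ⟨t, ht⟩ := (h _ memLp_two_gaussianWindow).exists
    rw [tfShift_tfShift] at ht
    refine (mul_eq_right₀ ?_).mp ht
    simp [tfShift, gaussianWindow_ne_zero]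
  · intro h f _
    refine Filter.Eventually.of_forall fun t => ?_
    rw [tfShift_tfShift, h, one_mul]

variable (Λ : Submodule ℤ (TFPlane d)) [DiscreteTopology Λ] [IsZLattice ℝ Λ]
variable {ι : Type*} [Fintype ι] (b : Module.Basis ι ℤ Λ)

theorem symplecticForm_eq_sum (z u : TFPlane d) :
    symplecticForm d z u = ∑ i, (b.ofZLatticeBasis ℝ Λ).repr u i * symplecticForm d z (b i) := by
  conv_lhs => rw [← (b.ofZLatticeBasis ℝ Λ).sum_repr u]
  simp

/-- The basis of the time-frequency plane dual to a basis of a lattice with respect to the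
symplectic form. -/
noncomputable def symplecticDualBasis : Module.Basis ι ℝ (TFPlane d) :=
  .ofEquivFun <| LinearMap.linearEquivOfInjective
    (LinearMap.pi fun i => (symplecticForm d).flip (b i : TFPlane d))
    (by
      rw [← LinearMap.ker_eq_bot, LinearMap.ker_eq_bot']
      intro z hz
      refine eq_zero_of_symplecticForm_eq_zero (LinearMap.ext fun u => ?_)
      rw [symplecticForm_eq_sum Λ b]
      exact Finset.sum_eq_zero fun i _ => mul_eq_zero_of_right _ (congrFun hz i))
    (by rw [Module.finrank_eq_card_basis (b.ofZLatticeBasis ℝ Λ), Module.finrank_fintype_fun_eq_card])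

theorem symplecticDualBasis_repr (z : TFPlane d) (i : ι) :
    (symplecticDualBasis Λ b).repr z i = symplecticForm d z (b i) := by
  rw [← Module.Basis.equivFun_apply]
  simp [symplecticDualBasis]

/-- The coordinates of `z` in the dual basis are its pairings with the `b i`, so integrality against
all of `Λ` means integer coordinates. -/
theorem adjointLattice_eq_span :
    adjointLattice (Λ : Set (TFPlane d)) =
      (Submodule.span ℤ (Set.range (symplecticDualBasis Λ b)) : Set (TFPlane d)) := by
  ext z
  rw [mem_adjointLattice_iff, SetLike.mem_coe, Module.Basis.mem_span_iff_repr_mem]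
  simp only [symplecticDualBasis_repr]
  constructor
  · intro h i
    exact h _ (b i).2
  · intro h l hl
    choose n hn using h
    refine ⟨∑ i, b.repr ⟨l, hl⟩ i * n i, ?_⟩
    have hr := b.ofZLatticeBasis_repr_apply ℝ Λ ⟨l, hl⟩
    rw [symplecticForm_eq_sum Λ b]
    push_cast
    refine Finset.sum_congr rfl fun i _ => ?_
    rw [hr, ← hn i]
    rfl

/-- The points of the adjoint lattice, indexed by their integer coordinates. -/
noncomputable def adjointLatticeEquiv : (ι → ℤ) ≃ adjointLattice (Λ : Set (TFPlane d)) :=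
  ((symplecticDualBasis Λ b).restrictScalars ℤ).equivFun.symm.toEquiv.trans
    (Equiv.setCongr (adjointLattice_eq_span Λ b).symm)

/-- Matches the characters of the Poisson formula with the exponentials of the symplectic Fourier
transform. -/
theorem symplecticForm_adjointLatticeEquiv (m : ι → ℤ) (u : TFPlane d) :
    symplecticForm d (adjointLatticeEquiv Λ b m) u =
      ∑ i, m i * (b.ofZLatticeBasis ℝ Λ).repr u i := by
  have hm : ∀ i, symplecticForm d (adjointLatticeEquiv Λ b m) (b i) = m i := fun i => by
    rw [← symplecticDualBasis_repr]
    have h1 := congrFun (((symplecticDualBasis Λ b).restrictScalars ℤ).equivFun.apply_symm_apply m) i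
    have h2 := (symplecticDualBasis Λ b).restrictScalars_repr_apply ℤ
      (((symplecticDualBasis Λ b).restrictScalars ℤ).equivFun.symm m) i
    rw [Module.Basis.equivFun_apply] at h1
    rw [h1] at h2
    exact h2.symm
  rw [symplecticForm_eq_sum Λ b]
  exact Finset.sum_congr rfl fun i _ => by rw [hm, mul_comm]

theorem exists_forall_tsum_adjointLattice_le {c : ℝ} (hc : 0 < c) :
    ∃ C : ℝ, ∀ x : TFPlane d,
      (Summable fun z : adjointLattice (Λ : Set (TFPlane d)) =>
        Real.exp (-c * ‖(z : TFPlane d) - x‖ ^ 2)) ∧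
      ∑' z : adjointLattice (Λ : Set (TFPlane d)), Real.exp (-c * ‖(z : TFPlane d) - x‖ ^ 2) ≤ C := by
  rw [adjointLattice_eq_span Λ (Module.Free.chooseBasis ℤ Λ)]
  exact ZLattice.exists_forall_tsum_exp_neg_mul_sq_norm_sub_le _ hc

theorem countable_adjointLattice : Countable (adjointLattice (Λ : Set (TFPlane d))) :=
  (adjointLatticeEquiv Λ (Module.Free.chooseBasis ℤ Λ)).symm.injective.countable

end Adjoint

/-! ### The formula for a pair of shifted Gaussians. -/

section GaussianPoisson

variable {d : ℕ}

theorem fourier_gaussianWindow (ω : TFSpace d) : 𝓕 (gaussianWindow d) ω = gaussianWindow d ω := by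
  have hpi : (Real.pi : ℂ) ≠ 0 := by exact_mod_cast Real.pi_ne_zero
  have h := fourier_gaussian_innerProductSpace (V := TFSpace d) (b := (Real.pi : ℂ))
    (by simpa using Real.pi_pos) ω
  refine h.trans ?_
  rw [div_self hpi, Complex.one_cpow, one_mul, gaussianWindow]
  congr 1
  field_simp

theorem fourier_tfShift_gaussianWindow (w : TFPlane d) (ω : TFSpace d) :
    𝓕 (tfShift w (gaussianWindow d)) ω =
      Complex.exp (-(2 * (Real.pi : ℂ) * Complex.I * ((inner ℝ (ω - w.2) w.1 : ℝ) : ℂ))) *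
        gaussianWindow d (ω - w.2) := by
  rw [← fourier_gaussianWindow, Real.fourier_eq', Real.fourier_eq',
    ← integral_add_right_eq_self _ w.1, ← integral_const_mul]
  congr 1 with t
  simp only [tfShift, add_sub_cancel_right, smul_eq_mul, ← mul_assoc, ← Complex.exp_add]
  congr 2
  simp only [inner_add_right, inner_add_left, inner_sub_left, inner_sub_right]
  rw [real_inner_comm t w.2, real_inner_comm ω w.1]
  push_cast
  ring

theorem norm_rihaczek (f g : TFSpace d → ℂ) (z : TFPlane d) :
    ‖rihaczek f g z‖ = ‖f z.1‖ * ‖𝓕 g z.2‖ := by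
  rw [rihaczek, norm_mul, norm_exp_neg_two_pi_I_mul, mul_one, norm_mul, RCLike.norm_conj]

theorem norm_rihaczek_tfShift_gaussianWindow_le (z w u : TFPlane d) :
    ‖rihaczek (tfShift z (gaussianWindow d)) (tfShift w (gaussianWindow d)) u‖ ≤
      Real.exp (-Real.pi * ‖u - (z.1, w.2)‖ ^ 2) := by
  rw [norm_rihaczek, norm_tfShift, fourier_tfShift_gaussianWindow, norm_mul,
    norm_exp_neg_two_pi_I_mul, one_mul, norm_gaussianWindow, norm_gaussianWindow]
  exact exp_mul_exp_neg_sq_norm_le Real.pi_pos.le (u - (z.1, w.2))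

theorem continuous_rihaczek_tfShift_gaussianWindow (u : TFPlane d) :
    Continuous fun p : TFPlane d × TFPlane d =>
      rihaczek (tfShift p.1 (gaussianWindow d)) (tfShift p.2 (gaussianWindow d)) u := by
  have := continuous_gaussianWindow (d := d)
  simp only [rihaczek, fourier_tfShift_gaussianWindow, tfShift]
  fun_prop

theorem integrable_tfShift_gaussianWindow (z : TFPlane d) :
    Integrable (tfShift z (gaussianWindow d)) := by
  refine (integrable_gaussianWindow.comp_sub_right z.1).mono
    (continuous_tfShift continuous_gaussianWindow z).aestronglyMeasurable
    (Filter.Eventually.of_forall fun t => ?_)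
  rw [norm_tfShift]

theorem norm_stft_tfShift_gaussianWindow_le' (z w l : TFPlane d) :
    ‖stft (tfShift w (gaussianWindow d)) (tfShift z (gaussianWindow d)) l‖ ≤
      Real.exp (-(Real.pi / 2) * ‖l - (z - w)‖ ^ 2) :=
  (norm_stft_tfShift_gaussianWindow_le z w l).trans
    (exp_mul_exp_neg_sq_norm_le (by positivity) (l - (z - w)))

theorem tsum_stft_tfShift_gaussianWindow (Λ : Submodule ℤ (TFPlane d)) [DiscreteTopology Λ]
    [IsZLattice ℝ Λ] (z w : TFPlane d) :
    ∑' l : Λ, stft (tfShift w (gaussianWindow d)) (tfShift z (gaussianWindow d)) l =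
      ((ZLattice.covolume Λ volume : ℝ) : ℂ)⁻¹ *
        ∑' u : adjointLattice (Λ : Set (TFPlane d)),
          rihaczek (tfShift z (gaussianWindow d)) (tfShift w (gaussianWindow d)) u := by
  let b := Module.Free.chooseBasis ℤ Λ
  set A := tfShift z (gaussianWindow d)
  set B := tfShift w (gaussianWindow d)
  have hA : Continuous A := continuous_tfShift continuous_gaussianWindow z
  have hB : Continuous B := continuous_tfShift continuous_gaussianWindow w
  have hVc : Continuous (stft B A) := by
    refine continuous_congr (stft_tfShift_gaussianWindow z w) |>.mpr ?_
    fun_prop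
  have hV : Integrable (stft B A) := integrable_stft_tfShift_gaussianWindow z w
  have hAB : ∀ x, Integrable fun t => A t * conj (B (t - x)) := fun x => by
    refine (integrable_tfShift_gaussianWindow z).mul_bdd (c := 1)
      (Continuous.aestronglyMeasurable (by fun_prop)) (Filter.Eventually.of_forall fun t => ?_)
    rw [RCLike.norm_conj, norm_tfShift]
    exact norm_gaussianWindow_le_one _
  have hcoef : ∀ m, ∫ u, ZLattice.char Λ b m u * stft B A u =
      rihaczek A B (adjointLatticeEquiv Λ b m) := fun m => by
    rw [← integral_stft_mul_exp_symplectic hA hB hAB hV]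
    congr 1 with u
    rw [ZLattice.char, ← symplecticForm_adjointLatticeEquiv, symplecticForm_apply]
  have hsum : Summable fun u : adjointLattice (Λ : Set (TFPlane d)) => rihaczek A B u := by
    obtain ⟨C, hC⟩ := exists_forall_tsum_adjointLattice_le Λ Real.pi_pos
    exact .of_norm_bounded (hC _).1 fun u => norm_rihaczek_tfShift_gaussianWindow_le z w u
  rw [ZLattice.tsum_eq_tsum_integral volume Λ b (h := stft B A) (C := 1) (c := Real.pi / 2)
    (a := z - w) hVc hV (by positivity)
    (fun u => by simpa only [one_mul] using norm_stft_tfShift_gaussianWindow_le' z w u)]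
  · simp only [hcoef]
    rw [(adjointLatticeEquiv Λ b).tsum_eq (fun u => rihaczek A B u)]
  · simp only [hcoef]
    exact (adjointLatticeEquiv Λ b).summable_iff.mpr hsum

end GaussianPoisson

/-! ### Interchanging sums and integrals under uniform bounds. -/

section Superposition

variable {P T ι : Type*} [MeasurableSpace P] [MeasurableSpace T] {μ : Measure T} {ν : Measure P}
  [SFinite μ] [SFinite ν]

theorem MeasureTheory.Integrable.mul_prod_of_integral_norm_le {H : P → ℂ} (hH : Integrable H ν)
    {k : T → P → ℂ} (hk : AEStronglyMeasurable (fun q : T × P => k q.1 q.2) (μ.prod ν))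
    (hkint : ∀ p, Integrable (fun t => k t p) μ) {C : ℝ} (hC : ∀ p, ∫ t, ‖k t p‖ ∂μ ≤ C) :
    Integrable (fun q : T × P => H q.2 * k q.1 q.2) (μ.prod ν) := by
  have hmeas : AEStronglyMeasurable (fun q : T × P => H q.2 * k q.1 q.2) (μ.prod ν) :=
    hH.1.comp_snd.mul hk
  rw [integrable_prod_iff' hmeas]
  refine ⟨Filter.Eventually.of_forall fun p => (hkint p).const_mul (H p), ?_⟩
  refine (hH.norm.mul_const C).mono' hmeas.norm.prod_swap.integral_prod_right'
    (Filter.Eventually.of_forall fun p => ?_)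
  rw [Real.norm_of_nonneg (integral_nonneg fun _ => norm_nonneg _)]
  simp only [norm_mul]
  rw [integral_const_mul]
  exact mul_le_mul_of_nonneg_left (hC p) (norm_nonneg _)

omit [SFinite ν] in
-- The bound `C` on the sums, uniform in `p`, makes `‖H‖ * C` an integrable majorant of every
-- partial sum of norms.
theorem summable_norm_integral_mul_and_tsum_eq [Countable ι] {H : P → ℂ} (hH : Integrable H ν)
    {K : ι → P → ℂ} (hK : ∀ i, AEStronglyMeasurable (K i) ν) {C : ℝ}
    (hs : ∀ p, Summable fun i => ‖K i p‖) (hC : ∀ p, ∑' i, ‖K i p‖ ≤ C) :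
    (Summable fun i => ‖∫ p, H p * K i p ∂ν‖) ∧
      ∑' i, ∫ p, H p * K i p ∂ν = ∫ p, H p * ∑' i, K i p ∂ν := by
  have hle : ∀ i p, ‖K i p‖ ≤ C := fun i p =>
    ((hs p).le_tsum i fun _ _ => norm_nonneg _).trans (hC p)
  have hint : ∀ i, Integrable (fun p => H p * K i p) ν := fun i =>
    hH.mul_bdd (hK i) (Filter.Eventually.of_forall (hle i))
  have hsum : Summable fun i => ∫ p, ‖H p * K i p‖ ∂ν := by
    refine summable_of_sum_le (c := ∫ p, ‖H p‖ * C ∂ν)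
      (fun i => integral_nonneg fun _ => norm_nonneg _) fun s => ?_
    rw [← integral_finsetSum _ fun i _ => (hint i).norm]
    refine integral_mono (integrable_finsetSum _ fun i _ => (hint i).norm)
      (hH.norm.mul_const C) fun p => ?_
    simp only [norm_mul, ← Finset.mul_sum]
    exact mul_le_mul_of_nonneg_left
      (((hs p).sum_le_tsum s fun _ _ => norm_nonneg _).trans (hC p)) (norm_nonneg _)
  refine ⟨hsum.of_nonneg_of_le (fun _ => norm_nonneg _) fun i => norm_integral_le_integral_norm _, ?_⟩
  rw [(hasSum_integral_of_summable_integral_norm hint hsum).tsum_eq]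
  simp only [tsum_mul_left]

end Superposition

/-! ### Superposition of both sides and the conclusion. -/

section Main

variable {d : ℕ} {f g : TFSpace d → ℂ} {F G : TFPlane d → ℂ}

/-- Fubini applies because the kernel is bounded by a translate of `γ` in `t`, whose `L¹` norm does
not depend on `p`. -/
theorem stft_eq_integral (hF : Integrable F) (hG : Integrable G)
    (hf : ∀ t, f t = ∫ z, F z * tfShift z (gaussianWindow d) t)
    (hg : ∀ t, g t = ∫ z, G z * tfShift z (gaussianWindow d) t) (l : TFPlane d) :
    stft g f l = ∫ p : TFPlane d × TFPlane d, (F p.1 * conj (G p.2)) *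
      stft (tfShift p.2 (gaussianWindow d)) (tfShift p.1 (gaussianWindow d)) l := by
  have hGc : Integrable fun w => conj (G w) :=
    (LinearIsometryEquiv.integrable_comp_iff (Complex.conjLIE)).mpr hG
  have hH : Integrable (fun p : TFPlane d × TFPlane d => F p.1 * conj (G p.2))
    (volume.prod volume) := hF.mul_prod hGc
  let k : TFSpace d → TFPlane d × TFPlane d → ℂ := fun t p =>
    tfShift p.1 (gaussianWindow d) t * conj (tfShift p.2 (gaussianWindow d) (t - l.1)) *
      Complex.exp (-(2 * (Real.pi : ℂ) * Complex.I * ((inner ℝ l.2 t : ℝ) : ℂ)))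
  have hγ := continuous_gaussianWindow (d := d)
  have hkc : Continuous fun q : TFSpace d × (TFPlane d × TFPlane d) => k q.1 q.2 := by
    simp only [k, tfShift]
    fun_prop
  have hkle : ∀ t p, ‖k t p‖ ≤ ‖gaussianWindow d (t - p.1.1)‖ := fun t p => by
    simp only [k]
    rw [norm_mul, norm_exp_neg_two_pi_I_mul, mul_one, norm_mul, RCLike.norm_conj, norm_tfShift,
      norm_tfShift]
    exact mul_le_of_le_one_right (norm_nonneg _) (norm_gaussianWindow_le_one _)
  have hγi : ∀ p : TFPlane d × TFPlane d, Integrable fun t => ‖gaussianWindow d (t - p.1.1)‖ :=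
    fun p => (integrable_gaussianWindow.comp_sub_right _).norm
  have hki : ∀ p, Integrable fun t => k t p := fun p =>
    (hγi p).mono' (hkc.comp (Continuous.prodMk_left p)).aestronglyMeasurable
      (Filter.Eventually.of_forall fun t => hkle t p)
  have hint := hH.mul_prod_of_integral_norm_le (μ := (volume : Measure (TFSpace d)))
    hkc.aestronglyMeasurable hki (C := ∫ t, ‖gaussianWindow d t‖) fun p => by
      rw [← integral_sub_right_eq_self (fun t => ‖gaussianWindow d t‖) p.1.1]
      exact integral_mono (hki p).norm (hγi p) fun t => hkle t p
  have hswap := integral_integral_swap (f := fun t p => F p.1 * conj (G p.2) * k t p) hint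
  calc stft g f l = ∫ t, ∫ p : TFPlane d × TFPlane d, F p.1 * conj (G p.2) * k t p
        ∂(volume.prod volume) := by
        rw [stft]
        congr 1 with t
        rw [hf t, hg (t - l.1), ← integral_conj, ← integral_prod_mul, ← integral_mul_const]
        congr 1 with p
        simp only [k, map_mul]
        ring
    _ = _ := hswap
    _ = _ := by
        congr 1 with p
        rw [integral_const_mul]
        rfl

theorem fourier_eq_integral (hG : Integrable G)
    (hg : ∀ t, g t = ∫ z, G z * tfShift z (gaussianWindow d) t) (ω : TFSpace d) :
    𝓕 g ω = ∫ w, G w * 𝓕 (tfShift w (gaussianWindow d)) ω := by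
  let k : TFSpace d → TFPlane d → ℂ := fun t w =>
    Complex.exp (((-2 * Real.pi * inner ℝ t ω : ℝ) : ℂ) * Complex.I) *
      tfShift w (gaussianWindow d) t
  have hγ := continuous_gaussianWindow (d := d)
  have hkc : Continuous fun q : TFSpace d × TFPlane d => k q.1 q.2 := by
    simp only [k, tfShift]
    fun_prop
  have hkle : ∀ t w, ‖k t w‖ = ‖gaussianWindow d (t - w.1)‖ := fun t w => by
    simp only [k]
    rw [norm_mul, Complex.norm_exp_ofReal_mul_I, one_mul, norm_tfShift]
  have hki : ∀ w, Integrable fun t => k t w := fun w =>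
    (integrable_gaussianWindow.comp_sub_right w.1).norm.mono'
      (hkc.comp (Continuous.prodMk_left w)).aestronglyMeasurable
      (Filter.Eventually.of_forall fun t => (hkle t w).le)
  have hint := hG.mul_prod_of_integral_norm_le (μ := (volume : Measure (TFSpace d)))
    hkc.aestronglyMeasurable hki (C := ∫ t, ‖gaussianWindow d t‖) fun w => by
      simp only [hkle]
      rw [integral_sub_right_eq_self (fun t => ‖gaussianWindow d t‖) w.1]
  have hswap := integral_integral_swap (f := fun t w => G w * k t w) hint
  rw [Real.fourier_eq']
  calc _ = ∫ t, ∫ w, G w * k t w := by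
        congr 1 with t
        rw [hg t, smul_eq_mul, ← integral_const_mul]
        congr 1 with w
        simp only [k]
        ring
    _ = _ := hswap
    _ = _ := by
        congr 1 with w
        rw [integral_const_mul, Real.fourier_eq']
        rfl

theorem rihaczek_eq_integral (hG : Integrable G)
    (hf : ∀ t, f t = ∫ z, F z * tfShift z (gaussianWindow d) t)
    (hg : ∀ t, g t = ∫ z, G z * tfShift z (gaussianWindow d) t) (u : TFPlane d) :
    rihaczek f g u = ∫ p : TFPlane d × TFPlane d, (F p.1 * conj (G p.2)) *
      rihaczek (tfShift p.1 (gaussianWindow d)) (tfShift p.2 (gaussianWindow d)) u := by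
  rw [rihaczek, fourier_eq_integral hG hg, hf, ← integral_conj, ← integral_prod_mul,
    ← integral_mul_const]
  congr 1 with p
  simp only [rihaczek, map_mul]
  ring

end Main

theorem mainTheorem5 (d : ℕ) (f g : TFSpace d → ℂ)
    (hf : MemFeichtingerAlgebra f) (hg : MemFeichtingerAlgebra g)
    (Λ : Submodule ℤ (TFPlane d)) [DiscreteTopology Λ] [IsZLattice ℝ Λ] :
    (Summable fun l : Λ => ‖stft g f (l : TFPlane d)‖) ∧
    (Summable fun z : adjointLattice (Λ : Set (TFPlane d)) => ‖rihaczek f g (z : TFPlane d)‖) ∧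
    ∑' l : Λ, stft g f (l : TFPlane d) =
      ((ZLattice.covolume Λ volume : ℝ) : ℂ)⁻¹ *
        ∑' z : adjointLattice (Λ : Set (TFPlane d)), rihaczek f g (z : TFPlane d) := by
  obtain ⟨F, hF, hfF⟩ := hf.exists_eq_integral_tfShift_gaussianWindow
  obtain ⟨G, hG, hgG⟩ := hg.exists_eq_integral_tfShift_gaussianWindow
  have hGc : Integrable fun w => conj (G w) :=
    (LinearIsometryEquiv.integrable_comp_iff (Complex.conjLIE)).mpr hG
  have hH : Integrable (fun p : TFPlane d × TFPlane d => F p.1 * conj (G p.2)) := hF.mul_prod hGc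
  have := countable_adjointLattice Λ
  obtain ⟨C, hC⟩ := ZLattice.exists_forall_tsum_exp_neg_mul_sq_norm_sub_le Λ
    (c := Real.pi / 2) (by positivity)
  obtain ⟨D, hD⟩ := exists_forall_tsum_adjointLattice_le Λ Real.pi_pos
  have hKs : ∀ p : TFPlane d × TFPlane d, Summable fun l : Λ =>
      ‖stft (tfShift p.2 (gaussianWindow d)) (tfShift p.1 (gaussianWindow d)) l‖ := fun p =>
    (hC (p.1 - p.2)).1.of_nonneg_of_le (fun _ => norm_nonneg _)
      fun l => norm_stft_tfShift_gaussianWindow_le' p.1 p.2 l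
  have hRs : ∀ p : TFPlane d × TFPlane d,
      Summable fun u : adjointLattice (Λ : Set (TFPlane d)) =>
        ‖rihaczek (tfShift p.1 (gaussianWindow d)) (tfShift p.2 (gaussianWindow d)) u‖ := fun p =>
    (hD (p.1.1, p.2.2)).1.of_nonneg_of_le (fun _ => norm_nonneg _)
      fun u => norm_rihaczek_tfShift_gaussianWindow_le p.1 p.2 u
  obtain ⟨hV, hVsum⟩ := summable_norm_integral_mul_and_tsum_eq hH
    (K := fun (l : Λ) p => stft (tfShift p.2 (gaussianWindow d)) (tfShift p.1 (gaussianWindow d)) l)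
    (fun l => (continuous_stft_tfShift_gaussianWindow.comp
      (Continuous.prodMk_left (l : TFPlane d))).aestronglyMeasurable) hKs
    fun p => ((hKs p).tsum_le_tsum
      (fun l : Λ => norm_stft_tfShift_gaussianWindow_le' p.1 p.2 l) (hC (p.1 - p.2)).1).trans
      (hC (p.1 - p.2)).2
  obtain ⟨hR, hRsum⟩ := summable_norm_integral_mul_and_tsum_eq hH
    (K := fun (u : adjointLattice (Λ : Set (TFPlane d))) p =>
      rihaczek (tfShift p.1 (gaussianWindow d)) (tfShift p.2 (gaussianWindow d)) u)
    (fun u => (continuous_rihaczek_tfShift_gaussianWindow _).aestronglyMeasurable) hRs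
    fun p => ((hRs p).tsum_le_tsum
      (fun u : adjointLattice (Λ : Set (TFPlane d)) =>
        norm_rihaczek_tfShift_gaussianWindow_le p.1 p.2 u) (hD (p.1.1, p.2.2)).1).trans
      (hD (p.1.1, p.2.2)).2
  simp only [← stft_eq_integral hF hG hfF hgG] at hV hVsum
  simp only [← rihaczek_eq_integral hG hfF hgG] at hR hRsum
  refine ⟨hV, hR, ?_⟩
  -- Both sides are now integrals against `F ⊗ conj G`, and their integrands agree by the formula
  -- for Gaussians.
  rw [hVsum, hRsum, ← integral_const_mul]
  congr 1 with p
  rw [tsum_stft_tfShift_gaussianWindow]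
  ring
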